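/- Let $A\in\mathbb R^{n\times n}$, $B\in\mathbb R^{n\times m}$, $C\in\mathbb R^{p\times n}$, let $Q\in\mathbb R^{n\times n}$ be symmetric positive semidefinite and $R\in\mathbb R^{p\times p}$ symmetric positive definite. They describe the linear system $x_{t+1}=Ax_t+Bu_t+w_t$, $y_t=Cx_t+v_t$ with zero-mean white noises $w_t,v_t$ of covariances $Q,R$. Assume that $(A,C)$ is observable and that $(A,Q^{1/2})$ is stabilizable. For a mean $\mu\in\mathbb R^n$ and a covariance $P\in\mathbb R^{n\times n}$ of the initial state $x_1$, the Kalman filter starts from $\hat x_1^-=\mu$, $P_1^-=P$ and runs for $t\ge 1$ as $$K_t=P_t^-C^\top(CP_t^-C^\top+R)^{-1},\quad \hat x_{t+1}^-=A\bigl(\hat x_t^-+K_t(y_t-C\hat x_t^-)\bigr)+Bu_t,\quad P_{t+1}^-=A(I-K_tC)P_t^-A^\top+Q .$$ Write $P_{t}^-(P)$ for the resulting covariances. Let $T_{ini}$ be the number of past samples, $u_{ini}=\mathrm{col}(u_1,\dots,u_{T_{ini}})$ and $y_{ini}=\mathrm{col}(y_1,\dots,y_{T_{ini}})$. The prediction is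 linear in the data and in $\mu$, and the matrices $\hat\theta^-_{T_{ini}+1}(P)$ and $\hat\psi^-_{T_{ini}+1}(P)$ are defined by $$\hat x^-_{T_{ini}+1}=\hat\theta^-_{T_{ini}+1}(P)\,\mathrm{col}(u_{ini},y_{ini})+\hat\psi^-_{T_{ini}+1}(P)\,\mu .$$ For a fixed prediction horizon $T$ let $O_f=\mathrm{col}(C,CA,\dots,CA^{T-1})$, let $G_f$ be the $T\times T$ block matrix whose block $(i,j)$ is $CA^{i-j-1}$ for $j<i$ and $0$ otherwise, and let $H_f=G_f(I_T\otimes B)$. Put $$\eta_f(P)=\bigl[\,O_f\hat\theta^-_{T_{ini}+1}(P)\;\; H_f\,\bigr],\qquad \mathcal Y_f(P)=O_fP^-_{T_{ini}+1}(P)O_f^\top+G_f(I_T\otimes Q)G_f^\top+I_T\otimes R .$$ Thus the filter started at $(\mu,P)$ predicts the next $T$ outputs with mean $\eta_f(P)\,\mathrm{col}(u_{ini},y_{ini},u_f)+O_f\hat\psi^-_{T_{ini}+1}(P)\mu$ and covariance $\mathcal Y_f(P)$, where $u_f$ collects the $T$ future inputs. Let $\Sigma$ and $P_1^-$ be any symmetric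 positive definite $n\times n$ matrices that do not depend on $T_{ini}$. ($\Sigma$ is the initial covariance, with initial mean $0$, that describes the asymptotic distribution of the conditional generative model; $P_1^-$ is the covariance of $x_1$ that the full-history Kalman filter has reached at time $1$.) Then there is a constant $\rho$ with $0<\rho<1$ such that, with $\|\cdot\|$ the spectral norm, $$\lim_{T_{ini}\to\infty}\|\eta_f(\Sigma)-\eta_f(P_1^-)\|\,\rho^{-T_{ini}}=0,$$ $$\lim_{T_{ini}\to\infty}\|O_f\hat\psi^-_{T_{ini}+1}(P_1^-)\|\,\rho^{-T_{ini}}=0,$$ $$\lim_{T_{ini}\to\infty}\|\mathcal Y_f(\Sigma)-\mathcal Y_f(P_1^-)\|\,\rho^{-T_{ini}}=0 .$$ -/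

import Mathlib

open Filter Topology
open scoped Matrix Kronecker MatrixOrder Matrix.Norms.L2Operator

noncomputable section

namespace KFGap

variable {n m p : ℕ}

/-- The real square matrix `A` is Schur stable: all its complex eigenvalues lie in the open unit
disc. -/
def IsSchurStable (A : Matrix (Fin n) (Fin n) ℝ) : Prop :=
  ∀ z ∈ spectrum ℂ (A.map (algebraMap ℝ ℂ)), ‖z‖ < 1

/-- The pair `(A, B)` is stabilizable: some linear state feedback makes it Schur stable. -/
def IsStabilizable (A : Matrix (Fin n) (Fin n) ℝ) (B : Matrix (Fin n) (Fin m) ℝ) : Prop :=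
  ∃ F : Matrix (Fin m) (Fin n) ℝ, IsSchurStable (A + B * F)

/-- The matrix `O_f = col(C, C A, …, C A ^ (T - 1))`. -/
def obsMatrix (A : Matrix (Fin n) (Fin n) ℝ) (C : Matrix (Fin p) (Fin n) ℝ) (T : ℕ) :
    Matrix (Fin T × Fin p) (Fin n) ℝ :=
  Matrix.of fun i j => (C * A ^ (i.1 : ℕ)) i.2 j

/-- The pair `(A, C)` is observable: `col(C, C A, …, C A ^ (n - 1))` has rank `n`. -/
def IsObservable (A : Matrix (Fin n) (Fin n) ℝ) (C : Matrix (Fin p) (Fin n) ℝ) : Prop :=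
  (obsMatrix A C n).rank = n

/-- The matrix `G_f`: its block in block row `i` and block column `j` is `C A ^ (i - j - 1)` when
`j < i`, and `0` otherwise. -/
def noiseMatrix (A : Matrix (Fin n) (Fin n) ℝ) (C : Matrix (Fin p) (Fin n) ℝ) (T : ℕ) :
    Matrix (Fin T × Fin p) (Fin T × Fin n) ℝ :=
  Matrix.of fun i j => if j.1 < i.1 then (C * A ^ ((i.1 : ℕ) - (j.1 : ℕ) - 1)) i.2 j.2 else 0

/-- The matrix `H_f = G_f (I_T ⊗ B)`. -/
def inputMatrix (A : Matrix (Fin n) (Fin n) ℝ) (B : Matrix (Fin n) (Fin m) ℝ)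
    (C : Matrix (Fin p) (Fin n) ℝ) (T : ℕ) : Matrix (Fin T × Fin p) (Fin T × Fin m) ℝ :=
  noiseMatrix A C T * ((1 : Matrix (Fin T) (Fin T) ℝ) ⊗ₖ B)

/-- The Kalman gain `K = P Cᵀ (C P Cᵀ + R)⁻¹` belonging to the prediction covariance `P`. -/
def gain (C : Matrix (Fin p) (Fin n) ℝ) (R : Matrix (Fin p) (Fin p) ℝ)
    (P : Matrix (Fin n) (Fin n) ℝ) : Matrix (Fin n) (Fin p) ℝ :=
  P * Cᵀ * (C * P * Cᵀ + R)⁻¹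

/-- The Kalman filter prediction covariance after `k` measurement updates, started from the
covariance `P` of the initial state. Time starts at `0` here, so that with the initial state
called `x_1` this is the matrix `P_{k+1}^-`. -/
def kfCov (A : Matrix (Fin n) (Fin n) ℝ) (C : Matrix (Fin p) (Fin n) ℝ)
    (Q : Matrix (Fin n) (Fin n) ℝ) (R : Matrix (Fin p) (Fin p) ℝ)
    (P : Matrix (Fin n) (Fin n) ℝ) : ℕ → Matrix (Fin n) (Fin n) ℝ
  | 0 => P
  | k + 1 => A * ((1 - gain C R (kfCov A C Q R P k) * C) * kfCov A C Q R P k) * Aᵀ + Q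

/-- The Kalman filter prediction of the state after `k` measurement updates, started from the
mean `μ` and the covariance `P` of the initial state, with inputs `u 0, u 1, …` and outputs
`y 0, y 1, …`. With the initial state called `x_1` this is the vector `x̂_{k+1}^-`. -/
def kfMean (A : Matrix (Fin n) (Fin n) ℝ) (B : Matrix (Fin n) (Fin m) ℝ)
    (C : Matrix (Fin p) (Fin n) ℝ) (Q : Matrix (Fin n) (Fin n) ℝ) (R : Matrix (Fin p) (Fin p) ℝ)
    (P : Matrix (Fin n) (Fin n) ℝ) (μ : Fin n → ℝ) (u : ℕ → Fin m → ℝ) (y : ℕ → Fin p → ℝ) :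
    ℕ → Fin n → ℝ
  | 0 => μ
  | k + 1 =>
    A *ᵥ (kfMean A B C Q R P μ u y k +
      gain C R (kfCov A C Q R P k) *ᵥ (y k - C *ᵥ kfMean A B C Q R P μ u y k)) + B *ᵥ u k

/-- The coefficient of `col(u_ini, y_ini)` in the Kalman filter prediction of the state after `k`
steps. Its columns are the predictions from the unit data vectors with initial mean `0`. -/
def thetaHat (A : Matrix (Fin n) (Fin n) ℝ) (B : Matrix (Fin n) (Fin m) ℝ)
    (C : Matrix (Fin p) (Fin n) ℝ) (Q : Matrix (Fin n) (Fin n) ℝ) (R : Matrix (Fin p) (Fin p) ℝ)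
    (k : ℕ) (P : Matrix (Fin n) (Fin n) ℝ) :
    Matrix (Fin n) ((Fin k × Fin m) ⊕ (Fin k × Fin p)) ℝ :=
  Matrix.of fun i j => match j with
    | Sum.inl s => kfMean A B C Q R P 0 (Pi.single (s.1 : ℕ) (Pi.single s.2 1)) 0 k i
    | Sum.inr s => kfMean A B C Q R P 0 0 (Pi.single (s.1 : ℕ) (Pi.single s.2 1)) k i

/-- The coefficient of the initial mean in the Kalman filter prediction of the state after `k`
steps. Its columns are the predictions from zero data with the unit vectors as initial means. -/
def psiHat (A : Matrix (Fin n) (Fin n) ℝ) (B : Matrix (Fin n) (Fin m) ℝ)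
    (C : Matrix (Fin p) (Fin n) ℝ) (Q : Matrix (Fin n) (Fin n) ℝ) (R : Matrix (Fin p) (Fin p) ℝ)
    (k : ℕ) (P : Matrix (Fin n) (Fin n) ℝ) : Matrix (Fin n) (Fin n) ℝ :=
  Matrix.of fun i j => kfMean A B C Q R P (Pi.single j 1) 0 0 k i

/-- The coefficient `η_f(P) = [O_f θ̂(P)  H_f]` of `z = col(u_ini, y_ini, u_f)` in the Kalman filter
prediction of the next `T` outputs from `Tini` past samples. -/
def etaF (A : Matrix (Fin n) (Fin n) ℝ) (B : Matrix (Fin n) (Fin m) ℝ)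
    (C : Matrix (Fin p) (Fin n) ℝ) (Q : Matrix (Fin n) (Fin n) ℝ) (R : Matrix (Fin p) (Fin p) ℝ)
    (T Tini : ℕ) (P : Matrix (Fin n) (Fin n) ℝ) :
    Matrix (Fin T × Fin p) (((Fin Tini × Fin m) ⊕ (Fin Tini × Fin p)) ⊕ (Fin T × Fin m)) ℝ :=
  Matrix.fromCols (obsMatrix A C T * thetaHat A B C Q R Tini P) (inputMatrix A B C T)

/-- The covariance `𝒴_f(P) = O_f P_{Tini+1}^-(P) O_fᵀ + G_f Q_f G_fᵀ + R_f` of the Kalman filter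
prediction of the next `T` outputs from `Tini` past samples, where `Q_f = I_T ⊗ Q` and
`R_f = I_T ⊗ R`. -/
def covF (A : Matrix (Fin n) (Fin n) ℝ) (C : Matrix (Fin p) (Fin n) ℝ)
    (Q : Matrix (Fin n) (Fin n) ℝ) (R : Matrix (Fin p) (Fin p) ℝ)
    (T Tini : ℕ) (P : Matrix (Fin n) (Fin n) ℝ) :
    Matrix (Fin T × Fin p) (Fin T × Fin p) ℝ :=
  obsMatrix A C T * kfCov A C Q R P Tini * (obsMatrix A C T)ᵀ
    + noiseMatrix A C T * ((1 : Matrix (Fin T) (Fin T) ℝ) ⊗ₖ Q) * (noiseMatrix A C T)ᵀ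
    + (1 : Matrix (Fin T) (Fin T) ℝ) ⊗ₖ R

section Linearity

variable (A : Matrix (Fin n) (Fin n) ℝ) (B : Matrix (Fin n) (Fin m) ℝ)
  (C : Matrix (Fin p) (Fin n) ℝ) (Q : Matrix (Fin n) (Fin n) ℝ) (R : Matrix (Fin p) (Fin p) ℝ)
  (P : Matrix (Fin n) (Fin n) ℝ)

/-- The Kalman filter prediction as a linear map of the initial mean and the data. -/
def kfLin (k : ℕ) :
    ((Fin n → ℝ) × (ℕ → Fin m → ℝ) × (ℕ → Fin p → ℝ)) →ₗ[ℝ] (Fin n → ℝ) where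
  toFun d := kfMean A B C Q R P d.1 d.2.1 d.2.2 k
  map_add' d e := by
    induction k with
    | zero => rfl
    | succ k ih =>
      simp only [kfMean, ih]
      simp only [Prod.fst_add, Prod.snd_add, Pi.add_apply, Matrix.mulVec_add, Matrix.mulVec_sub]
      abel
  map_smul' c d := by
    induction k with
    | zero => rfl
    | succ k ih =>
      simp only [kfMean, ih, RingHom.id_apply]
      simp only [Prod.smul_fst, Prod.smul_snd, Pi.smul_apply, Matrix.mulVec_add, Matrix.mulVec_sub,
        Matrix.mulVec_smul, smul_add, smul_sub]

theorem kfMean_congr (μ : Fin n → ℝ) (u u' : ℕ → Fin m → ℝ) (y y' : ℕ → Fin p → ℝ) (k : ℕ)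
    (hu : ∀ t < k, u t = u' t) (hy : ∀ t < k, y t = y' t) :
    kfMean A B C Q R P μ u y k = kfMean A B C Q R P μ u' y' k := by
  induction k with
  | zero => rfl
  | succ k ih =>
    simp only [kfMean]
    rw [ih (fun t ht => hu t (by omega)) (fun t ht => hy t (by omega)), hu k (by omega),
      hy k (by omega)]

theorem sum_single_apply {q k : ℕ} (v : ℕ → Fin q → ℝ) (t : ℕ) (ht : t < k) :
    v t = (∑ s : Fin k × Fin q,
      v s.1 s.2 • (Pi.single (s.1 : ℕ) (Pi.single s.2 1) : ℕ → Fin q → ℝ)) t := by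
  ext i
  simp only [Finset.sum_apply, Pi.smul_apply, smul_eq_mul]
  rw [Finset.sum_eq_single (⟨t, ht⟩, i)]
  · simp
  · rintro ⟨s, j⟩ - hne
    by_cases hs : t = (s : ℕ)
    · subst hs
      have hj : i ≠ j := by
        rintro rfl
        exact hne rfl
      simp [Pi.single_eq_of_ne hj]
    · simp [Pi.single_eq_of_ne hs]
  · simp

/-- The matrices `thetaHat` and `psiHat` are the coefficients of the data and of the initial mean
in the Kalman filter prediction. -/
theorem kfMean_eq (μ : Fin n → ℝ) (u : ℕ → Fin m → ℝ) (y : ℕ → Fin p → ℝ) (k : ℕ) :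
    kfMean A B C Q R P μ u y k =
      thetaHat A B C Q R k P *ᵥ
          Sum.elim (fun s : Fin k × Fin m => u s.1 s.2) (fun s : Fin k × Fin p => y s.1 s.2)
        + psiHat A B C Q R k P *ᵥ μ := by
  have key : kfLin A B C Q R P k
      ((∑ j, μ j • ((Pi.single j 1 : Fin n → ℝ), (0 : ℕ → Fin m → ℝ), (0 : ℕ → Fin p → ℝ)))
        + (∑ s : Fin k × Fin m, u s.1 s.2 • ((0 : Fin n → ℝ),
            (Pi.single (s.1 : ℕ) (Pi.single s.2 1) : ℕ → Fin m → ℝ), (0 : ℕ → Fin p → ℝ)))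
        + (∑ s : Fin k × Fin p, y s.1 s.2 • ((0 : Fin n → ℝ), (0 : ℕ → Fin m → ℝ),
            (Pi.single (s.1 : ℕ) (Pi.single s.2 1) : ℕ → Fin p → ℝ))))
      = kfMean A B C Q R P μ u y k := by
    have h1 : (∑ j, μ j • (Pi.single j 1 : Fin n → ℝ)) = μ := by
      ext i
      simp [Finset.sum_apply, Pi.single_apply]
    change kfMean A B C Q R P _ _ _ k = _
    simp only [Prod.fst_add, Prod.snd_add, Prod.fst_sum, Prod.snd_sum, Prod.smul_fst,
      Prod.smul_snd, smul_zero, Finset.sum_const_zero, add_zero, zero_add, h1]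
    exact (kfMean_congr A B C Q R P μ _ _ _ _ k (fun t ht => sum_single_apply u t ht)
      (fun t ht => sum_single_apply y t ht)).symm
  rw [← key]
  simp only [map_add, map_sum, map_smul]
  ext i
  simp only [Pi.add_apply, Finset.sum_apply, Pi.smul_apply, smul_eq_mul, Matrix.mulVec, dotProduct,
    Fintype.sum_sum_type, Sum.elim_inl, Sum.elim_inr, thetaHat, psiHat, Matrix.of_apply, kfLin,
    LinearMap.coe_mk, AddHom.coe_mk]
  simp only [mul_comm]
  ring

end Linearity

end KFGap

end

noncomputable section

namespace KFGap

variable {n m p : ℕ}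

/-! All three quantities are governed by the products of the closed-loop matrices `A (1 - K C)`. The
coefficient of the initial mean is such a product, and the difference of two covariance sequences is
the initial difference with one filter's product on the left and the transpose of the other's on the
right (`kfCov_sub_kfCov`). The gain difference inherits this decay, and it forces the difference of
the two means through an equally stable recursion (`kfMean_sub_succ`).

So everything rests on uniform exponential stability of the time-varying closed loop,
`exists_transMat_bound`. Observability bounds the covariances (`kfCov_bounded`): the optimal filter
does no worse than a deadbeat observer, which forgets its start in `n` steps. Stabilizability
supplies a Lyapunov function for `A + Q^{1/2} F`. The dual closed loop is that stable system plus a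
disturbance, and the energy `z · P_k z` dissipates enough to pay for the disturbance. Both together
give a Lyapunov function with a uniform rate.

The Riccati limit is never used; the two filters are compared directly. -/

/-- The matrix of one step of the filter error dynamics. -/
def closedLoop (A : Matrix (Fin n) (Fin n) ℝ) (C : Matrix (Fin p) (Fin n) ℝ)
    (R : Matrix (Fin p) (Fin p) ℝ) (P : Matrix (Fin n) (Fin n) ℝ) : Matrix (Fin n) (Fin n) ℝ :=
  A * (1 - gain C R P * C)

/-! ### Algebra of the Riccati recursion. -/

section Riccati

variable (A : Matrix (Fin n) (Fin n) ℝ) (C : Matrix (Fin p) (Fin n) ℝ)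
  (Q : Matrix (Fin n) (Fin n) ℝ) {R : Matrix (Fin p) (Fin p) ℝ}
  {P : Matrix (Fin n) (Fin n) ℝ}

theorem posDef_innovation (hR : R.PosDef) (hP : P.PosSemidef) : (C * P * Cᵀ + R).PosDef := by
  have := hP.mul_mul_conjTranspose_same C
  rw [Matrix.conjTranspose_eq_transpose_of_trivial] at this
  exact Matrix.PosDef.posSemidef_add this hR

theorem transpose_eq_of_posSemidef {k : ℕ} {X : Matrix (Fin k) (Fin k) ℝ} (hX : X.PosSemidef) :
    Xᵀ = X := by
  rw [← Matrix.conjTranspose_eq_transpose_of_trivial]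
  exact hX.isHermitian

theorem isUnit_det_innovation (hR : R.PosDef) (hP : P.PosSemidef) :
    IsUnit (C * P * Cᵀ + R).det :=
  (posDef_innovation C hR hP).det_pos.ne'.isUnit

theorem gain_mul_innovation (hR : R.PosDef) (hP : P.PosSemidef) :
    gain C R P * (C * P * Cᵀ + R) = P * Cᵀ := by
  rw [gain, Matrix.mul_assoc (P * Cᵀ), Matrix.nonsing_inv_mul _ (isUnit_det_innovation C hR hP),
    Matrix.mul_one]

theorem innovation_mul_gain_transpose (hR : R.PosDef) (hP : P.PosSemidef) :
    (C * P * Cᵀ + R) * (gain C R P)ᵀ = C * P := by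
  have h := congrArg Matrix.transpose (gain_mul_innovation C hR hP)
  rwa [Matrix.transpose_mul, Matrix.transpose_mul, Matrix.transpose_transpose,
    transpose_eq_of_posSemidef (posDef_innovation C hR hP).posSemidef,
    transpose_eq_of_posSemidef hP] at h

/-- Completion of squares in the Riccati recursion. -/
theorem riccati_completion {ι : Type*} [Fintype ι] (hR : R.PosDef) (hP : P.PosSemidef)
    (Z : Matrix (Fin n) ι ℝ) (V : Matrix (Fin p) ι ℝ) :
    (Aᵀ * Z - Cᵀ * V)ᵀ * P * (Aᵀ * Z - Cᵀ * V) + Vᵀ * R * V + Zᵀ * Q * Z =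
      Zᵀ * (A * ((1 - gain C R P * C) * P) * Aᵀ + Q) * Z +
        (V - (gain C R P)ᵀ * Aᵀ * Z)ᵀ * (C * P * Cᵀ + R) * (V - (gain C R P)ᵀ * Aᵀ * Z) := by
  set K := gain C R P with hK
  set X := C * P * Cᵀ + R with hX
  have h1 : K * X = P * Cᵀ := gain_mul_innovation C hR hP
  have h2 : X * Kᵀ = C * P := innovation_mul_gain_transpose C hR hP
  have e1 : (V - Kᵀ * Aᵀ * Z)ᵀ * X * (V - Kᵀ * Aᵀ * Z) =
      Vᵀ * X * V - Vᵀ * (X * Kᵀ) * (Aᵀ * Z) - Zᵀ * A * (K * X) * V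
        + Zᵀ * A * K * (X * Kᵀ) * (Aᵀ * Z) := by
    simp only [Matrix.transpose_sub, Matrix.transpose_mul, Matrix.transpose_transpose,
      Matrix.sub_mul, Matrix.mul_sub, Matrix.mul_assoc]
    abel
  rw [e1, h1, h2, hX]
  simp only [Matrix.transpose_sub, Matrix.transpose_mul, Matrix.transpose_transpose,
      Matrix.sub_mul, Matrix.mul_sub, Matrix.mul_add, Matrix.add_mul, Matrix.mul_assoc,
      Matrix.one_mul]
  abel

/-- The Joseph form of the Riccati recursion. -/
theorem riccati_joseph (hR : R.PosDef) (hP : P.PosSemidef) :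
    A * ((1 - gain C R P * C) * P) * Aᵀ + Q =
      closedLoop A C R P * P * (closedLoop A C R P)ᵀ
        + A * gain C R P * R * (A * gain C R P)ᵀ + Q := by
  -- This choice of `V` makes the completed square vanish.
  have h := riccati_completion A C Q hR hP 1 ((gain C R P)ᵀ * Aᵀ)
  have e : Aᵀ - Cᵀ * ((gain C R P)ᵀ * Aᵀ) = (closedLoop A C R P)ᵀ := by
    simp only [closedLoop, Matrix.transpose_sub, Matrix.transpose_mul,
      Matrix.sub_mul, Matrix.mul_assoc, Matrix.transpose_one, Matrix.one_mul]
  simp only [Matrix.mul_one, Matrix.one_mul, Matrix.transpose_one, sub_self, Matrix.mul_zero,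
    add_zero, e, Matrix.transpose_transpose] at h
  rw [← h, Matrix.transpose_mul A, Matrix.transpose_mul, Matrix.transpose_transpose,
    Matrix.transpose_transpose]

theorem riccati_posSemidef (hQ : Q.PosSemidef) (hR : R.PosDef) (hP : P.PosSemidef) :
    (A * ((1 - gain C R P * C) * P) * Aᵀ + Q).PosSemidef := by
  rw [riccati_joseph A C Q hR hP]
  simp only [← Matrix.conjTranspose_eq_transpose_of_trivial]
  exact ((hP.mul_mul_conjTranspose_same _).add
    (hR.posSemidef.mul_mul_conjTranspose_same _)).add hQ

theorem kfCov_posSemidef (hQ : Q.PosSemidef) (hR : R.PosDef) (hP : P.PosSemidef) (k : ℕ) :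
    (kfCov A C Q R P k).PosSemidef := by
  induction k with
  | zero => exact hP
  | succ k ih => exact riccati_posSemidef A C Q hQ hR ih

/-- The difference of the gains of two covariances. -/
theorem gain_sub_gain (hR : R.PosDef) {P' : Matrix (Fin n) (Fin n) ℝ} (hP : P.PosSemidef)
    (hP' : P'.PosSemidef) :
    gain C R P' - gain C R P =
      (1 - gain C R P * C) * (P' - P) * Cᵀ * (C * P' * Cᵀ + R)⁻¹ := by
  have h1 := gain_mul_innovation C hR hP
  have e : (1 - gain C R P * C) * (P' - P) * Cᵀ =
      P' * Cᵀ - gain C R P * (C * P' * Cᵀ + R) := by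
    have : (1 - gain C R P * C) * (P' - P) * Cᵀ = P' * Cᵀ - P * Cᵀ
        - (gain C R P * (C * P' * Cᵀ + R) - gain C R P * (C * P * Cᵀ + R)) := by
      simp only [Matrix.sub_mul, Matrix.mul_sub, Matrix.mul_add, Matrix.mul_assoc, Matrix.one_mul]
      abel
    rw [this, h1]
    abel
  rw [e, Matrix.sub_mul, Matrix.mul_assoc (gain C R P),
    Matrix.mul_nonsing_inv _ (isUnit_det_innovation C hR hP'), Matrix.mul_one, gain]

/-- The difference of two Riccati steps. -/
theorem riccati_sub_riccati (hR : R.PosDef) {P' : Matrix (Fin n) (Fin n) ℝ} (hP : P.PosSemidef)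
    (hP' : P'.PosSemidef) :
    (A * ((1 - gain C R P' * C) * P') * Aᵀ + Q) - (A * ((1 - gain C R P * C) * P) * Aᵀ + Q) =
      closedLoop A C R P' * (P' - P) * (closedLoop A C R P)ᵀ := by
  have h1 := gain_mul_innovation C hR hP'
  have h2 := innovation_mul_gain_transpose C hR hP
  have h3 : gain C R P' * (C * P' * Cᵀ) * (gain C R P)ᵀ
      = P' * Cᵀ * (gain C R P)ᵀ - gain C R P' * R * (gain C R P)ᵀ := by
    rw [← h1, ← Matrix.sub_mul, ← Matrix.mul_sub, add_sub_cancel_right]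
  have h4 : gain C R P' * (C * P * Cᵀ) * (gain C R P)ᵀ
      = gain C R P' * (C * P) - gain C R P' * R * (gain C R P)ᵀ := by
    rw [eq_sub_iff_add_eq, ← Matrix.add_mul, ← Matrix.mul_add, Matrix.mul_assoc, h2]
  have h5 : gain C R P * (C * P) = P * Cᵀ * (gain C R P)ᵀ := by
    rw [← h2, ← gain_mul_innovation C hR hP, ← Matrix.mul_assoc]
  -- The two gains come from different covariances, yet the terms `K' R Kᵀ` produced by `h3` and
  -- `h4` cancel, so the difference factors exactly, without a quadratic remainder.
  have e : (1 - gain C R P' * C) * P' - (1 - gain C R P * C) * P =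
      (1 - gain C R P' * C) * (P' - P) * (1 - gain C R P * C)ᵀ := by
    have : (1 - gain C R P' * C) * (P' - P) * (1 - gain C R P * C)ᵀ =
        P' - P - gain C R P' * (C * P') + gain C R P' * (C * P)
         - P' * Cᵀ * (gain C R P)ᵀ + P * Cᵀ * (gain C R P)ᵀ
         + gain C R P' * (C * P' * Cᵀ) * (gain C R P)ᵀ
         - gain C R P' * (C * P * Cᵀ) * (gain C R P)ᵀ := by
      simp only [Matrix.sub_mul, Matrix.mul_sub, Matrix.mul_assoc, Matrix.one_mul,
        Matrix.transpose_sub, Matrix.transpose_one, Matrix.transpose_mul, Matrix.mul_one]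
      abel
    rw [this, h3, h4, ← h5]
    simp only [Matrix.sub_mul, Matrix.one_mul, Matrix.mul_assoc]
    abel
  rw [add_sub_add_right_eq_sub, ← Matrix.sub_mul, ← Matrix.mul_sub, e, closedLoop, closedLoop,
    Matrix.transpose_mul]
  simp only [Matrix.mul_assoc]

end Riccati

/-! ### Spectral norm and quadratic forms. -/

section Norms

variable {α β : Type*} [Fintype α] [Fintype β]

theorem dotProduct_self_eq_norm_sq (z : β → ℝ) : z ⬝ᵥ z = ‖WithLp.toLp 2 z‖ ^ 2 := by
  rw [EuclideanSpace.real_norm_sq_eq]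
  simp [dotProduct, sq]

theorem abs_apply_le_norm_toLp (z : β → ℝ) (i : β) : |z i| ≤ ‖WithLp.toLp 2 z‖ := by
  have := PiLp.norm_apply_le (p := 2) (WithLp.toLp 2 z) i
  simpa using this

theorem posSemidef_dotProduct_nonneg {X : Matrix β β ℝ} (hX : X.PosSemidef) (z : β → ℝ) :
    0 ≤ z ⬝ᵥ (X *ᵥ z) := by
  simpa using hX.dotProduct_mulVec_nonneg z

variable [DecidableEq β]

theorem norm_toLp_mulVec_le (X : Matrix α β ℝ) (z : β → ℝ) :
    ‖WithLp.toLp 2 (X *ᵥ z)‖ ≤ ‖X‖ * ‖WithLp.toLp 2 z‖ :=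
  Matrix.l2_opNorm_mulVec X (WithLp.toLp 2 z)

theorem mulVec_dotProduct_mulVec_le (X : Matrix α β ℝ) (z : β → ℝ) :
    (X *ᵥ z) ⬝ᵥ (X *ᵥ z) ≤ ‖X‖ ^ 2 * (z ⬝ᵥ z) := by
  classical
  rw [dotProduct_self_eq_norm_sq, dotProduct_self_eq_norm_sq, ← mul_pow]
  exact pow_le_pow_left₀ (norm_nonneg _) (norm_toLp_mulVec_le X z) 2

theorem dotProduct_mulVec_le (X : Matrix β β ℝ) (z : β → ℝ) :
    z ⬝ᵥ (X *ᵥ z) ≤ ‖X‖ * (z ⬝ᵥ z) := by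
  have h : z ⬝ᵥ (X *ᵥ z) = inner ℝ (WithLp.toLp 2 (X *ᵥ z)) (WithLp.toLp 2 z) := by
    simp [EuclideanSpace.inner_eq_star_dotProduct]
  rw [h, dotProduct_self_eq_norm_sq]
  calc _ ≤ ‖WithLp.toLp 2 (X *ᵥ z)‖ * ‖WithLp.toLp 2 z‖ := real_inner_le_norm _ _
    _ ≤ (‖X‖ * ‖WithLp.toLp 2 z‖) * ‖WithLp.toLp 2 z‖ := by
      gcongr
      exact norm_toLp_mulVec_le X z
    _ = _ := by ring

theorem l2_opNorm_le_of_sq_le (X : Matrix α β ℝ) {c : ℝ} (hc : 0 ≤ c)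
    (h : ∀ z, (X *ᵥ z) ⬝ᵥ (X *ᵥ z) ≤ c ^ 2 * (z ⬝ᵥ z)) : ‖X‖ ≤ c := by
  classical
  rw [Matrix.l2_opNorm_def]
  refine ContinuousLinearMap.opNorm_le_bound _ hc fun x => ?_
  have := h x.ofLp
  rw [dotProduct_self_eq_norm_sq, dotProduct_self_eq_norm_sq, ← mul_pow] at this
  exact le_of_sq_le_sq this (by positivity)

theorem l2_opNorm_transpose [DecidableEq α] (X : Matrix α β ℝ) : ‖Xᵀ‖ = ‖X‖ := by
  rw [← Matrix.conjTranspose_eq_transpose_of_trivial, Matrix.l2_opNorm_conjTranspose]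

theorem l2_opNorm_single_le [DecidableEq α] (i : α) (j : β) (x : ℝ) :
    ‖Matrix.single i j x‖ ≤ |x| := by
  refine l2_opNorm_le_of_sq_le _ (abs_nonneg x) fun z => ?_
  rw [Matrix.single_mulVec]
  simp only [sq_abs]
  have h : (Function.update (0 : α → ℝ) i (x * z j)) = Pi.single i (x * z j) := rfl
  rw [h, single_dotProduct, Pi.single_eq_same]
  have : z j * z j ≤ z ⬝ᵥ z :=
    Finset.single_le_sum (f := fun j => z j * z j) (fun j _ => mul_self_nonneg _)
      (Finset.mem_univ j)
  nlinarith [mul_le_mul_of_nonneg_left this (sq_nonneg x)]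

/-- Crude, but it costs only a factor polynomial in the matrix size, which exponential decay
absorbs. -/
theorem l2_opNorm_le_sum_abs [DecidableEq α] (X : Matrix α β ℝ) :
    ‖X‖ ≤ ∑ i, ∑ j, |X i j| := by
  conv_lhs => rw [Matrix.matrix_eq_sum_single X]
  refine (norm_sum_le _ _).trans (Finset.sum_le_sum fun i _ => ?_)
  exact (norm_sum_le _ _).trans (Finset.sum_le_sum fun j _ => l2_opNorm_single_le i j _)

theorem sqrt_mulVec_dotProduct {X : Matrix β β ℝ} (hX : X.PosSemidef) (z : β → ℝ) :
    (CFC.sqrt X *ᵥ z) ⬝ᵥ (CFC.sqrt X *ᵥ z) = z ⬝ᵥ (X *ᵥ z) := by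
  have h1 : (CFC.sqrt X)ᵀ = CFC.sqrt X := by
    rw [← Matrix.conjTranspose_eq_transpose_of_trivial]
    exact (Matrix.nonneg_iff_posSemidef.1 (CFC.sqrt_nonneg X)).isHermitian
  have h2 : CFC.sqrt X * CFC.sqrt X = X :=
    CFC.sqrt_mul_sqrt_self X (Matrix.nonneg_iff_posSemidef.2 hX)
  conv_rhs => rw [← h2, ← Matrix.mulVec_mulVec, Matrix.dotProduct_mulVec, ← Matrix.mulVec_transpose,
    h1]

theorem exists_pos_le_of_posDef {X : Matrix β β ℝ} (hX : X.PosDef) :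
    ∃ r : ℝ, 0 < r ∧ ∀ z, r * (z ⬝ᵥ z) ≤ z ⬝ᵥ (X *ᵥ z) := by
  have h2 : CFC.sqrt X * CFC.sqrt X = X :=
    CFC.sqrt_mul_sqrt_self X (Matrix.nonneg_iff_posSemidef.2 hX.posSemidef)
  have h3 : IsUnit (CFC.sqrt X).det := by
    have := hX.det_pos.ne'
    rw [← h2, Matrix.det_mul] at this
    exact (left_ne_zero_of_mul this).isUnit
  -- From `z = X^{-1/2} X^{1/2} z`; the `+ 1` keeps the constant positive in dimension zero too.
  refine ⟨(‖(CFC.sqrt X)⁻¹‖ ^ 2 + 1)⁻¹, by positivity, fun z => ?_⟩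
  rw [inv_mul_le_iff₀ (by positivity), ← sqrt_mulVec_dotProduct hX.posSemidef]
  have := mulVec_dotProduct_mulVec_le (CFC.sqrt X)⁻¹ (CFC.sqrt X *ᵥ z)
  rw [Matrix.mulVec_mulVec, Matrix.nonsing_inv_mul _ h3, Matrix.one_mulVec] at this
  have h0 : 0 ≤ (CFC.sqrt X *ᵥ z) ⬝ᵥ (CFC.sqrt X *ᵥ z) :=
    Finset.sum_nonneg fun i _ => mul_self_nonneg _
  linarith

/-- With `y = X⁻¹ z`, coercivity and Cauchy-Schwarz give `r |y|² ≤ y · z ≤ |y| |z|`; symmetry of `X`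
plays no role. -/
theorem norm_inv_le_of_le {X : Matrix β β ℝ} (hX : IsUnit X.det) {r : ℝ} (hr : 0 < r)
    (h : ∀ z, r * (z ⬝ᵥ z) ≤ z ⬝ᵥ (X *ᵥ z)) : ‖X⁻¹‖ ≤ r⁻¹ := by
  refine l2_opNorm_le_of_sq_le _ (by positivity) fun z => ?_
  set y := X⁻¹ *ᵥ z with hy
  have hz : X *ᵥ y = z := by
    rw [hy, Matrix.mulVec_mulVec, Matrix.mul_nonsing_inv _ hX, Matrix.one_mulVec]
  have h1 := h y
  rw [hz] at h1
  have h2 : 0 ≤ (r • y - z) ⬝ᵥ (r • y - z) :=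
    Finset.sum_nonneg fun i _ => mul_self_nonneg _
  have h3 : (r • y - z) ⬝ᵥ (r • y - z) = r ^ 2 * (y ⬝ᵥ y) - 2 * r * (y ⬝ᵥ z) + z ⬝ᵥ z := by
    simp only [sub_dotProduct, dotProduct_sub, smul_dotProduct, dotProduct_smul, smul_eq_mul,
      dotProduct_comm z y]
    ring
  have h4 : r * (r * (y ⬝ᵥ y)) ≤ r * (y ⬝ᵥ z) := mul_le_mul_of_nonneg_left h1 hr.le
  have h5 : (y ⬝ᵥ z) ^ 2 ≤ (y ⬝ᵥ y) * (z ⬝ᵥ z) := by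
    simpa [dotProduct, sq] using
      Finset.sum_mul_sq_le_sq_mul_sq Finset.univ y z
  rw [inv_pow, ← div_eq_inv_mul, le_div_iff₀ (by positivity)]
  have hyy : 0 ≤ y ⬝ᵥ y := Finset.sum_nonneg fun i _ => mul_self_nonneg _
  rcases hyy.eq_or_lt with h0 | h0
  · rw [← h0, zero_mul]
    exact Finset.sum_nonneg fun i _ => mul_self_nonneg _
  · have h6 : (r * (y ⬝ᵥ y)) ^ 2 ≤ (y ⬝ᵥ y) * (z ⬝ᵥ z) :=
      (pow_le_pow_left₀ (by positivity) h1 2).trans h5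
    refine le_of_mul_le_mul_left ?_ h0
    linarith

end Norms

/-! ### Observability and uniform bounds on the covariance. -/

section Observability

variable {A : Matrix (Fin n) (Fin n) ℝ} {C : Matrix (Fin p) (Fin n) ℝ}

theorem exists_left_inverse_obsMatrix (h : IsObservable A C) :
    ∃ G : Matrix (Fin n) (Fin n × Fin p) ℝ, G * obsMatrix A C n = 1 := by
  rw [← Matrix.vecMul_surjective_iff_exists_left_inverse]
  have h1 : (obsMatrix A C n)ᵀ.rank = n := by rw [Matrix.rank_transpose]; exact h
  have h2 : LinearMap.range (obsMatrix A C n)ᵀ.mulVecLin = ⊤ := by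
    apply Submodule.eq_top_of_finrank_eq
    rw [Matrix.rank] at h1
    simpa using h1
  intro v
  obtain ⟨w, hw⟩ := LinearMap.range_eq_top.1 h2 v
  exact ⟨w, by rw [← hw, Matrix.mulVecLin_apply, Matrix.mulVec_transpose]⟩

/-- An observable pair admits a deadbeat observer: the dual system is steered to zero. -/
theorem exists_deadbeat (h : IsObservable A C) :
    ∃ (Z : ℕ → Matrix (Fin n) (Fin n) ℝ) (V : ℕ → Matrix (Fin p) (Fin n) ℝ),
      Z 0 = 1 ∧ (∀ i, Z (i + 1) = Aᵀ * Z i - Cᵀ * V i) ∧ Z n = 0 := by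
  obtain ⟨G, hG⟩ := exists_left_inverse_obsMatrix h
  -- The controls are the blocks of `A ^ n * G`, because `A ^ n * G * O = A ^ n` expresses `Aᵀ ^ n`
  -- through the dual controllability matrix. They are applied in reverse order since the control at
  -- time `i` is later multiplied by `Aᵀ ^ (n - 1 - i)`.
  let V' : ℕ → Matrix (Fin p) (Fin n) ℝ := fun j =>
    if hj : j < n then Matrix.of fun a b => (A ^ n * G) b (⟨j, hj⟩, a) else 0
  let V : ℕ → Matrix (Fin p) (Fin n) ℝ := fun i => V' (n - 1 - i)
  have key : ∑ j ∈ Finset.range n, Aᵀ ^ j * Cᵀ * V' j = Aᵀ ^ n := by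
    have h1 : A ^ n * G * obsMatrix A C n = A ^ n := by
      rw [Matrix.mul_assoc, hG, Matrix.mul_one]
    rw [← Matrix.transpose_pow, ← h1, Finset.sum_range]
    ext a b
    rw [Matrix.sum_apply, Matrix.transpose_apply, Matrix.mul_apply, Fintype.sum_prod_type]
    refine Finset.sum_congr rfl fun j _ => ?_
    rw [← Matrix.transpose_pow, ← Matrix.transpose_mul, Matrix.mul_apply]
    refine Finset.sum_congr rfl fun c _ => ?_
    simp [V', obsMatrix, mul_comm]
  refine ⟨fun i => Aᵀ ^ i - ∑ l ∈ Finset.range i, Aᵀ ^ (i - 1 - l) * Cᵀ * V l, V, ?_, ?_, ?_⟩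
  · simp
  · intro i
    beta_reduce
    rw [Finset.sum_range_succ, Matrix.mul_sub, Matrix.mul_sum, pow_succ', ← sub_sub]
    congr 1
    · congr 1
      refine Finset.sum_congr rfl fun l hl => ?_
      have hl := Finset.mem_range.1 hl
      rw [show i + 1 - 1 - l = (i - 1 - l) + 1 by omega, pow_succ']
      simp only [Matrix.mul_assoc]
    · simp
  · have := Finset.sum_range_reflect (fun j => Aᵀ ^ j * Cᵀ * V' j) n
    simp only [V]
    rw [this, key, sub_self]

/-- Dropping the completed square compares the optimal gains with the deadbeat ones. After `n` steps
the deadbeat error no longer depends on the covariance at its start, which leaves one bound for all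
later times; the first `n` covariances are bounded separately. -/
theorem kfCov_bounded {Q : Matrix (Fin n) (Fin n) ℝ} {R : Matrix (Fin p) (Fin p) ℝ}
    {P : Matrix (Fin n) (Fin n) ℝ} (hQ : Q.PosSemidef) (hR : R.PosDef) (hP : P.PosSemidef)
    (h : IsObservable A C) :
    ∃ c : ℝ, 0 ≤ c ∧ ∀ k z, z ⬝ᵥ (kfCov A C Q R P k *ᵥ z) ≤ c * (z ⬝ᵥ z) := by
  obtain ⟨Z, V, hZ0, hZ, hZn⟩ := exists_deadbeat h
  -- `W` must not depend on `k`: it collects only the noise costs of the fixed sequences `Z` and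
  -- `V`.
  have key : ∀ i, ∃ W : Matrix (Fin n) (Fin n) ℝ, ∀ k,
      ((Z i)ᵀ * kfCov A C Q R P k * Z i + W - kfCov A C Q R P (k + i)).PosSemidef := by
    intro i
    induction i with
    | zero => exact ⟨0, fun k => by simp [hZ0, Matrix.PosSemidef.zero]⟩
    | succ i ih =>
      obtain ⟨W, hW⟩ := ih
      refine ⟨W + (V i)ᵀ * R * V i + (Z i)ᵀ * Q * Z i, fun k => ?_⟩
      have hk := kfCov_posSemidef A C Q hQ hR hP k
      have h1 := riccati_completion A C Q hR hk (Z i) (V i)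
      have h2 := (posDef_innovation C hR hk).posSemidef.conjTranspose_mul_mul_same
        (V i - (gain C R (kfCov A C Q R P k))ᵀ * Aᵀ * Z i)
      rw [Matrix.conjTranspose_eq_transpose_of_trivial] at h2
      have h3 := (hW (k + 1)).add h2
      rw [← hZ] at h1
      rw [show k + (i + 1) = k + 1 + i by omega]
      convert h3 using 1
      rw [kfCov.eq_2 A C Q R P k]
      rw [show ∀ a b c d e : Matrix (Fin n) (Fin n) ℝ, a + (b + c + d) - e = (a + c + d) + b - e
        from fun a b c d e => by abel, h1]
      abel
  obtain ⟨W, hW⟩ := key n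
  refine ⟨‖W‖ + ∑ j ∈ Finset.range n, ‖kfCov A C Q R P j‖, by positivity, fun k z => ?_⟩
  have hz : 0 ≤ z ⬝ᵥ z := Finset.sum_nonneg fun i _ => mul_self_nonneg _
  rw [add_mul]
  rcases lt_or_ge k n with hk | hk
  · have h1 := dotProduct_mulVec_le (kfCov A C Q R P k) z
    have h2 : ‖kfCov A C Q R P k‖ ≤ ∑ j ∈ Finset.range n, ‖kfCov A C Q R P j‖ :=
      Finset.single_le_sum (f := fun j => ‖kfCov A C Q R P j‖) (fun j _ => norm_nonneg _)
        (Finset.mem_range.2 hk)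
    have h3 := mul_le_mul_of_nonneg_right h2 hz
    have h4 : 0 ≤ ‖W‖ * (z ⬝ᵥ z) := by positivity
    linarith
  · obtain ⟨j, rfl⟩ := Nat.exists_eq_add_of_le' hk
    have h1 := posSemidef_dotProduct_nonneg (hW j) z
    rw [hZn, Matrix.mul_zero, zero_add, Matrix.sub_mulVec, dotProduct_sub] at h1
    have h2 := dotProduct_mulVec_le W z
    have h4 : 0 ≤ (∑ j ∈ Finset.range n, ‖kfCov A C Q R P j‖) * (z ⬝ᵥ z) := by positivity
    linarith

end Observability

/-! ### Schur stability and quadratic Lyapunov functions. -/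

section Schur

/-- Gelfand's formula: eventually `‖a ^ k‖ < r ^ k` for some `r < 1` above the spectral radius. -/
theorem tendsto_pow_of_spectrum_norm_lt_one {E : Type*} [NormedRing E] [NormedAlgebra ℂ E]
    [CompleteSpace E] [Nontrivial E] {a : E} (h : ∀ z ∈ spectrum ℂ a, ‖z‖ < 1) :
    Tendsto (fun k => a ^ k) atTop (𝓝 0) := by
  have h1 : spectralRadius ℂ a < ((1 : NNReal) : ENNReal) :=
    spectrum.spectralRadius_lt_of_forall_lt_of_nonempty (spectrum.nonempty a)
      fun k hk => by exact_mod_cast h k hk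
  obtain ⟨r, hr1, hr2⟩ := ENNReal.lt_iff_exists_nnreal_btwn.1 h1
  have hr : r < 1 := by exact_mod_cast hr2
  have h2 := (spectrum.pow_nnnorm_pow_one_div_tendsto_nhds_spectralRadius a).eventually_lt_const hr1
  refine squeeze_zero_norm' ?_ (tendsto_pow_atTop_nhds_zero_of_lt_one r.coe_nonneg
    (by exact_mod_cast hr))
  filter_upwards [h2, eventually_gt_atTop 0] with k hk hk0
  have h3 := ENNReal.rpow_le_rpow hk.le (Nat.cast_nonneg (α := ℝ) k)
  rw [← ENNReal.rpow_mul, one_div, inv_mul_cancel₀ (by positivity), ENNReal.rpow_one,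
    ENNReal.rpow_natCast] at h3
  exact_mod_cast h3

theorem IsSchurStable.tendsto_pow {M : Matrix (Fin n) (Fin n) ℝ} (h : IsSchurStable M) :
    Tendsto (fun k => M ^ k) atTop (𝓝 0) := by
  rcases Nat.eq_zero_or_pos n with rfl | hn
  · exact tendsto_const_nhds.congr fun k => Subsingleton.elim _ _
  · have : Nonempty (Fin n) := ⟨⟨0, hn⟩⟩
    have h1 := tendsto_pow_of_spectrum_norm_lt_one h
    have h2 := ((continuous_id.matrix_map Complex.continuous_re).tendsto 0).comp h1
    have h3 : (0 : Matrix (Fin n) (Fin n) ℂ).map Complex.re = 0 := by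
      ext
      simp
    simp only [id, h3] at h2
    refine h2.congr fun k => ?_
    ext i j
    simp only [Function.comp_apply, ← Matrix.map_pow, Matrix.map_apply]
    simp

theorem IsSchurStable.exists_norm_transpose_pow_le {M : Matrix (Fin n) (Fin n) ℝ}
    (h : IsSchurStable M) : ∃ N, 0 < N ∧ ‖Mᵀ ^ N‖ ^ 2 ≤ 1 / 2 := by
  have h1 := h.tendsto_pow.norm.pow 2
  simp only [norm_zero, ne_eq, OfNat.ofNat_ne_zero, not_false_eq_true, zero_pow] at h1
  obtain ⟨N, hN, hN0⟩ := ((h1.eventually_le_const (u := 1 / 2) (by norm_num)).and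
    (eventually_gt_atTop 0)).exists
  exact ⟨N, hN0, by rwa [← Matrix.transpose_pow, l2_opNorm_transpose]⟩

/-- A quadratic Lyapunov function of a discrete-time system with a disturbance. -/
theorem exists_lyapunov (M : Matrix (Fin n) (Fin n) ℝ) {N : ℕ} (hN : 0 < N)
    (h : ‖M ^ N‖ ^ 2 ≤ 1 / 2) :
    ∃ (V : (Fin n → ℝ) → ℝ) (c : ℝ), 0 < c ∧ (∀ z, z ⬝ᵥ z ≤ V z) ∧ (∀ z, V z ≤ c * (z ⬝ᵥ z)) ∧
      ∀ z d, V (M *ᵥ z + d) ≤ V z - 1 / 4 * (z ⬝ᵥ z) + c * (d ⬝ᵥ d) := by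
  -- A truncated Lyapunov sum: `V (M z) - V z` telescopes to `|M ^ N z|² - |z|²`, which is at most
  -- `-|z|² / 2`.
  let V : (Fin n → ℝ) → ℝ := fun z => ∑ k ∈ Finset.range N, (M ^ k *ᵥ z) ⬝ᵥ (M ^ k *ᵥ z)
  have hnn : ∀ z : Fin n → ℝ, 0 ≤ z ⬝ᵥ z := fun z => Finset.sum_nonneg fun i _ => mul_self_nonneg _
  have hV1 : ∀ z, z ⬝ᵥ z ≤ V z := fun z => by
    have := Finset.single_le_sum (f := fun k => (M ^ k *ᵥ z) ⬝ᵥ (M ^ k *ᵥ z))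
      (fun k _ => hnn _) (Finset.mem_range.2 hN)
    simpa using this
  set b : ℝ := ∑ k ∈ Finset.range N, ‖M ^ k‖ ^ 2 + 1 with hb
  have hb0 : 1 ≤ b := by
    rw [hb]
    have : 0 ≤ ∑ k ∈ Finset.range N, ‖M ^ k‖ ^ 2 := by positivity
    linarith
  have hV2 : ∀ z, V z ≤ b * (z ⬝ᵥ z) := fun z => by
    have : V z ≤ ∑ k ∈ Finset.range N, ‖M ^ k‖ ^ 2 * (z ⬝ᵥ z) :=
      Finset.sum_le_sum fun k _ => mulVec_dotProduct_mulVec_le _ _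
    rw [← Finset.sum_mul] at this
    rw [hb, add_mul]
    linarith [hnn z]
  have hVM : ∀ z, V (M *ᵥ z) ≤ V z - 1 / 2 * (z ⬝ᵥ z) := fun z => by
    have h1 : V (M *ᵥ z) = ∑ k ∈ Finset.range N, (M ^ (k + 1) *ᵥ z) ⬝ᵥ (M ^ (k + 1) *ᵥ z) :=
      Finset.sum_congr rfl fun k _ => by rw [Matrix.mulVec_mulVec, ← pow_succ]
    have h2 := Finset.sum_range_succ (fun k => (M ^ k *ᵥ z) ⬝ᵥ (M ^ k *ᵥ z)) N
    rw [Finset.sum_range_succ', ← h1] at h2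
    have h3 := (mulVec_dotProduct_mulVec_le (M ^ N) z).trans
      (mul_le_mul_of_nonneg_right h (hnn z))
    simp only [pow_zero, Matrix.one_mulVec] at h2
    linarith
  have hVadd : ∀ ε : ℝ, 0 < ε → ∀ x d, V (x + d) ≤ (1 + ε) * V x + (1 + ε⁻¹) * V d := by
    intro ε hε x d
    rw [Finset.mul_sum, Finset.mul_sum, ← Finset.sum_add_distrib]
    refine Finset.sum_le_sum fun k _ => ?_
    rw [Matrix.mulVec_add]
    simp only [dotProduct]
    rw [Finset.mul_sum, Finset.mul_sum, ← Finset.sum_add_distrib]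
    refine Finset.sum_le_sum fun i _ => ?_
    simp only [Pi.add_apply]
    generalize (M ^ k *ᵥ x) i = s
    generalize (M ^ k *ᵥ d) i = t
    have h1 : (1 + ε) * (s * s) + (1 + ε⁻¹) * (t * t) - (s + t) * (s + t) =
        ε⁻¹ * (ε * s - t) ^ 2 := by
      field_simp
      ring
    have h2 : 0 ≤ ε⁻¹ * (ε * s - t) ^ 2 := by positivity
    linarith
  refine ⟨V, (1 + 4 * b) * b, by positivity, hV1, fun z => (hV2 z).trans ?_, fun z d => ?_⟩
  · gcongr
    · exact hnn z
    · nlinarith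
  -- Young's inequality with this weight loses at most `V z / (4 b) ≤ |z|² / 4`, half of the
  -- available decrease.
  · have h1 := hVadd (4 * b)⁻¹ (by positivity) (M *ᵥ z) d
    rw [inv_inv] at h1
    have h2 : (1 + 4 * b) * V d ≤ (1 + 4 * b) * b * (d ⬝ᵥ d) := by
      rw [mul_assoc]
      exact mul_le_mul_of_nonneg_left (hV2 d) (by positivity)
    have h3 : (1 + (4 * b)⁻¹) * V (M *ᵥ z) ≤ V z - 1 / 4 * (z ⬝ᵥ z) := by
      calc _ ≤ (1 + (4 * b)⁻¹) * (V z - 1 / 2 * (z ⬝ᵥ z)) :=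
            mul_le_mul_of_nonneg_left (hVM z) (by positivity)
        _ ≤ V z - 1 / 2 * (z ⬝ᵥ z) + (4 * b)⁻¹ * V z := by
            have : 0 ≤ (4 * b)⁻¹ * (z ⬝ᵥ z) := mul_nonneg (by positivity) (hnn z)
            linarith
        _ ≤ _ := by
            have : (4 * b)⁻¹ * V z ≤ 1 / 4 * (z ⬝ᵥ z) := by
              rw [inv_mul_le_iff₀ (by positivity)]
              linarith [hV2 z]
            linarith
    linarith

end Schur

/-! ### Uniform exponential stability of the filter error dynamics. -/

/-- The transition matrix over `i` steps from time `s` of the filter error dynamics. -/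
def transMat (A : Matrix (Fin n) (Fin n) ℝ) (C : Matrix (Fin p) (Fin n) ℝ)
    (Q : Matrix (Fin n) (Fin n) ℝ) (R : Matrix (Fin p) (Fin p) ℝ)
    (P : Matrix (Fin n) (Fin n) ℝ) (s : ℕ) : ℕ → Matrix (Fin n) (Fin n) ℝ
  | 0 => 1
  | i + 1 => closedLoop A C R (kfCov A C Q R P (s + i)) * transMat A C Q R P s i

section Stability

variable {A : Matrix (Fin n) (Fin n) ℝ} {C : Matrix (Fin p) (Fin n) ℝ}
  {Q : Matrix (Fin n) (Fin n) ℝ} {R : Matrix (Fin p) (Fin p) ℝ} {P : Matrix (Fin n) (Fin n) ℝ}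

/-- One step of the dual filter dynamics in terms of a stabilized system. -/
theorem closedLoop_transpose_mulVec (W F : Matrix (Fin n) (Fin n) ℝ) (hW : Wᵀ = W)
    (z : Fin n → ℝ) :
    (closedLoop A C R P)ᵀ *ᵥ z =
      (A + W * F)ᵀ *ᵥ z + -(Fᵀ *ᵥ (W *ᵥ z) + Cᵀ *ᵥ ((A * gain C R P)ᵀ *ᵥ z)) := by
  simp only [Matrix.mulVec_mulVec, ← Matrix.add_mulVec, ← Matrix.neg_mulVec]
  congr 1
  simp only [closedLoop, Matrix.mul_sub, Matrix.mul_one, Matrix.transpose_sub, Matrix.transpose_add,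
    Matrix.transpose_mul, hW, Matrix.mul_assoc]
  abel

/-- The energy balance of one step of the dual filter dynamics. -/
theorem dotProduct_riccati (hR : R.PosDef) (hP : P.PosSemidef) (z : Fin n → ℝ) :
    z ⬝ᵥ ((A * ((1 - gain C R P * C) * P) * Aᵀ + Q) *ᵥ z) =
      ((closedLoop A C R P)ᵀ *ᵥ z) ⬝ᵥ (P *ᵥ ((closedLoop A C R P)ᵀ *ᵥ z))
      + ((A * gain C R P)ᵀ *ᵥ z) ⬝ᵥ (R *ᵥ ((A * gain C R P)ᵀ *ᵥ z)) + z ⬝ᵥ (Q *ᵥ z) := by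
  have h : ∀ {a b : ℕ} (X : Matrix (Fin a) (Fin b) ℝ) (Y : Matrix (Fin b) (Fin b) ℝ)
      (z : Fin a → ℝ), z ⬝ᵥ ((X * Y * Xᵀ) *ᵥ z) = (Xᵀ *ᵥ z) ⬝ᵥ (Y *ᵥ (Xᵀ *ᵥ z)) := by
    intro a b X Y z
    rw [← Matrix.mulVec_mulVec, ← Matrix.mulVec_mulVec, Matrix.dotProduct_mulVec,
      ← Matrix.mulVec_transpose]
  rw [riccati_joseph A C Q hR hP, Matrix.add_mulVec, Matrix.add_mulVec, dotProduct_add,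
    dotProduct_add, h, h]

theorem add_dotProduct_self_le {a : ℕ} (x y : Fin a → ℝ) :
    (-(x + y)) ⬝ᵥ (-(x + y)) ≤ 2 * (x ⬝ᵥ x) + 2 * (y ⬝ᵥ y) := by
  have : 0 ≤ (x - y) ⬝ᵥ (x - y) := Finset.sum_nonneg fun i _ => mul_self_nonneg _
  simp only [neg_dotProduct_neg, add_dotProduct, dotProduct_add, sub_dotProduct,
    dotProduct_sub] at this ⊢
  linarith [dotProduct_comm x y]

/-- The filter error dynamics is uniformly exponentially stable. -/
theorem exists_transMat_bound (hQ : Q.PosSemidef) (hR : R.PosDef) (hP : P.PosSemidef)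
    (hobs : IsObservable A C) (hstab : IsStabilizable A (CFC.sqrt Q)) :
    ∃ c q : ℝ, 0 < c ∧ 0 < q ∧ q < 1 ∧ ∀ s i, ‖transMat A C Q R P s i‖ ≤ c * q ^ i := by
  obtain ⟨F, hF⟩ := hstab
  obtain ⟨N, hN, hN2⟩ := hF.exists_norm_transpose_pow_le
  obtain ⟨V, c, hc, hV1, hV2, hV3⟩ := exists_lyapunov _ hN hN2
  obtain ⟨b, hb, hPb⟩ := kfCov_bounded hQ hR hP hobs
  obtain ⟨r, hr, hRr⟩ := exists_pos_le_of_posDef hR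
  have hnn : ∀ {a : ℕ} (z : Fin a → ℝ), 0 ≤ z ⬝ᵥ z :=
    fun z => Finset.sum_nonneg fun i _ => mul_self_nonneg _
  have hpsd := kfCov_posSemidef A C Q hQ hR hP
  -- `β` is chosen so that the disturbance cost in the Lyapunov step is at most `β` times `v · R v +
  -- z · Q z`, the energy lost in `dotProduct_riccati`. Adding `β` times that energy to `V`
  -- therefore cancels the disturbance.
  set β : ℝ := c * (2 * ‖Fᵀ‖ ^ 2 + 2 * ‖Cᵀ‖ ^ 2 * r⁻¹) with hβ
  have hβ0 : 0 ≤ β := by positivity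
  let U : ℕ → (Fin n → ℝ) → ℝ := fun k z => V z + β * (z ⬝ᵥ (kfCov A C Q R P k *ᵥ z))
  have hUlow : ∀ k z, z ⬝ᵥ z ≤ U k z := fun k z =>
    (hV1 z).trans (le_add_of_nonneg_right
      (mul_nonneg hβ0 (posSemidef_dotProduct_nonneg (hpsd k) z)))
  set D : ℝ := c + β * b with hD
  have hD0 : 0 < D := by positivity
  have hUup : ∀ k z, U k z ≤ D * (z ⬝ᵥ z) := fun k z => by
    have := mul_le_mul_of_nonneg_left (hPb k z) hβ0
    simp only [U, hD, add_mul]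
    linarith [hV2 z]
  -- The decrease `|z|² / 4` is at least `U / (4 D + 1)`; the `+ 1` ensures `q > 0`.
  set q : ℝ := 1 - (4 * D + 1)⁻¹ with hq
  have hinv : (4 * D + 1)⁻¹ < 1 := inv_lt_one_of_one_lt₀ (by linarith)
  have hq0 : 0 < q := by linarith
  have hq1 : q < 1 := by
    have : 0 < (4 * D + 1)⁻¹ := by positivity
    linarith
  have hstep : ∀ k z, U k ((closedLoop A C R (kfCov A C Q R P k))ᵀ *ᵥ z) ≤ q * U (k + 1) z := by
    intro k z
    have h1 := dotProduct_riccati (A := A) (C := C) (Q := Q) hR (hpsd k) z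
    have hW : (CFC.sqrt Q)ᵀ = CFC.sqrt Q :=
      transpose_eq_of_posSemidef (Matrix.nonneg_iff_posSemidef.1 (CFC.sqrt_nonneg Q))
    have h2 := hV3 z (-(Fᵀ *ᵥ (CFC.sqrt Q *ᵥ z)
      + Cᵀ *ᵥ ((A * gain C R (kfCov A C Q R P k))ᵀ *ᵥ z)))
    rw [← closedLoop_transpose_mulVec (R := R) (P := kfCov A C Q R P k) _ F hW z] at h2
    set v := (A * gain C R (kfCov A C Q R P k))ᵀ *ᵥ z with hv
    have h3 := add_dotProduct_self_le (Fᵀ *ᵥ (CFC.sqrt Q *ᵥ z)) (Cᵀ *ᵥ v)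
    have h4 := mulVec_dotProduct_mulVec_le Fᵀ (CFC.sqrt Q *ᵥ z)
    rw [sqrt_mulVec_dotProduct hQ] at h4
    have h5 := mulVec_dotProduct_mulVec_le Cᵀ v
    have h6 : v ⬝ᵥ v ≤ r⁻¹ * (v ⬝ᵥ (R *ᵥ v)) := by
      rw [← div_eq_inv_mul, le_div_iff₀ hr, mul_comm]
      exact hRr v
    have h7 := h5.trans (mul_le_mul_of_nonneg_left h6 (sq_nonneg _))
    have hQz := posSemidef_dotProduct_nonneg hQ z
    have hRv := posSemidef_dotProduct_nonneg hR.posSemidef v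
    have h8 : (-(Fᵀ *ᵥ (CFC.sqrt Q *ᵥ z) + Cᵀ *ᵥ v)) ⬝ᵥ (-(Fᵀ *ᵥ (CFC.sqrt Q *ᵥ z) + Cᵀ *ᵥ v))
        ≤ (2 * ‖Fᵀ‖ ^ 2 + 2 * ‖Cᵀ‖ ^ 2 * r⁻¹) * (v ⬝ᵥ (R *ᵥ v) + z ⬝ᵥ (Q *ᵥ z)) := by
      have e1 : 0 ≤ 2 * ‖Fᵀ‖ ^ 2 * (v ⬝ᵥ (R *ᵥ v)) := by positivity
      have e2 : 0 ≤ 2 * ‖Cᵀ‖ ^ 2 * r⁻¹ * (z ⬝ᵥ (Q *ᵥ z)) := by positivity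
      linarith
    have h9 := mul_le_mul_of_nonneg_left h8 hc.le
    rw [← mul_assoc, ← hβ] at h9
    have h10 : U k ((closedLoop A C R (kfCov A C Q R P k))ᵀ *ᵥ z)
        ≤ U (k + 1) z - 1 / 4 * (z ⬝ᵥ z) := by
      simp only [U, kfCov.eq_2 A C Q R P k]
      rw [h1]
      linarith
    have h11 : (4 * D + 1)⁻¹ * U (k + 1) z ≤ 1 / 4 * (z ⬝ᵥ z) := by
      rw [inv_mul_le_iff₀ (by positivity)]
      linarith [hUup (k + 1) z, hnn z]
    rw [hq, sub_mul, one_mul]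
    linarith
  -- The transposed dynamics runs backwards in time, from `s + i` down to `s`.
  have hiter : ∀ s i z, U s ((transMat A C Q R P s i)ᵀ *ᵥ z) ≤ q ^ i * U (s + i) z := by
    intro s i
    induction i with
    | zero => intro z; simp [transMat]
    | succ i ih =>
      intro z
      rw [transMat, Matrix.transpose_mul, ← Matrix.mulVec_mulVec]
      refine (ih _).trans ?_
      rw [pow_succ, mul_assoc]
      exact mul_le_mul_of_nonneg_left (hstep (s + i) z) (by positivity)
  refine ⟨√D, √q, by positivity, by positivity, by rwa [Real.sqrt_lt' one_pos, one_pow],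
    fun s i => ?_⟩
  rw [← l2_opNorm_transpose]
  refine l2_opNorm_le_of_sq_le _ (by positivity) fun z => ?_
  rw [mul_pow, ← pow_mul, mul_comm i, pow_mul, Real.sq_sqrt hD0.le, Real.sq_sqrt hq0.le]
  calc _ ≤ _ := hUlow s _
    _ ≤ _ := hiter s i z
    _ ≤ q ^ i * (D * (z ⬝ᵥ z)) := mul_le_mul_of_nonneg_left (hUup _ z) (by positivity)
    _ = _ := by ring

end Stability

/-! ### Comparison of two filters. -/

section Comparison

variable {A : Matrix (Fin n) (Fin n) ℝ} {B : Matrix (Fin n) (Fin m) ℝ}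
  {C : Matrix (Fin p) (Fin n) ℝ} {Q : Matrix (Fin n) (Fin n) ℝ} {R : Matrix (Fin p) (Fin p) ℝ}
  {P P' : Matrix (Fin n) (Fin n) ℝ}

/-- In the energy balance `z · P_{k+1} z` dominates `v · R v` with `v = (A K)ᵀ z`, so bounded
covariances and `R ≥ r` bound the gain. -/
theorem exists_gain_bound (hQ : Q.PosSemidef) (hR : R.PosDef) (hP : P.PosSemidef)
    (hobs : IsObservable A C) :
    ∃ c : ℝ, 0 < c ∧ ∀ k, ‖A * gain C R (kfCov A C Q R P k)‖ ≤ c := by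
  obtain ⟨b, hb, hPb⟩ := kfCov_bounded hQ hR hP hobs
  obtain ⟨r, hr, hRr⟩ := exists_pos_le_of_posDef hR
  refine ⟨√(r⁻¹ * b + 1), by positivity, fun k => ?_⟩
  have hk := kfCov_posSemidef A C Q hQ hR hP k
  rw [← l2_opNorm_transpose]
  refine l2_opNorm_le_of_sq_le _ (by positivity) fun z => ?_
  rw [Real.sq_sqrt (by positivity)]
  have h1 := dotProduct_riccati (A := A) (C := C) (Q := Q) hR hk z
  rw [← kfCov.eq_2 A C Q R P k] at h1
  have h2 := hPb (k + 1) z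
  have h3 := posSemidef_dotProduct_nonneg hQ z
  have h4 := posSemidef_dotProduct_nonneg hk ((closedLoop A C R (kfCov A C Q R P k))ᵀ *ᵥ z)
  have h5 := hRr ((A * gain C R (kfCov A C Q R P k))ᵀ *ᵥ z)
  have hz : 0 ≤ z ⬝ᵥ z := Finset.sum_nonneg fun i _ => mul_self_nonneg _
  rw [add_mul, one_mul, mul_assoc]
  refine le_add_of_le_of_nonneg ?_ hz
  rw [← div_eq_inv_mul, le_div_iff₀ hr]
  linarith

/-- Iterating `riccati_sub_riccati` puts one filter's closed loops on the left and the other's on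
the right. -/
theorem kfCov_sub_kfCov (hQ : Q.PosSemidef) (hR : R.PosDef) (hP : P.PosSemidef)
    (hP' : P'.PosSemidef) (k : ℕ) :
    kfCov A C Q R P' k - kfCov A C Q R P k =
      transMat A C Q R P' 0 k * (P' - P) * (transMat A C Q R P 0 k)ᵀ := by
  induction k with
  | zero => simp [kfCov, transMat]
  | succ k ih =>
    rw [kfCov, kfCov, riccati_sub_riccati A C Q hR (kfCov_posSemidef A C Q hQ hR hP k)
      (kfCov_posSemidef A C Q hQ hR hP' k), ih, transMat, transMat, Matrix.transpose_mul]
    simp only [Matrix.mul_assoc, zero_add]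

/-- The prediction covariances of two filters approach each other exponentially. -/
theorem kfCov_sub_norm_le (hQ : Q.PosSemidef) (hR : R.PosDef) (hP : P.PosSemidef)
    (hP' : P'.PosSemidef) {c q : ℝ} (hc : 0 < c) (hq : 0 < q) (hq1 : q < 1)
    (hb : ∀ s i, ‖transMat A C Q R P s i‖ ≤ c * q ^ i)
    (hb' : ∀ s i, ‖transMat A C Q R P' s i‖ ≤ c * q ^ i) (k : ℕ) :
    ‖kfCov A C Q R P' k - kfCov A C Q R P k‖ ≤ (c * ‖P' - P‖ * c) * q ^ k := by
  rw [kfCov_sub_kfCov hQ hR hP hP']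
  have hqk : q ^ k ≤ 1 := pow_le_one₀ hq.le hq1.le
  calc _ ≤ ‖transMat A C Q R P' 0 k‖ * ‖P' - P‖ * ‖(transMat A C Q R P 0 k)ᵀ‖ :=
        (Matrix.l2_opNorm_mul _ _).trans
          (mul_le_mul_of_nonneg_right (Matrix.l2_opNorm_mul _ _) (norm_nonneg _))
    -- Both outer factors decay, but one power of `q ^ k` is enough.
    _ ≤ (c * q ^ k) * ‖P' - P‖ * (c * 1) := by
        rw [l2_opNorm_transpose]
        gcongr
        · exact hb' 0 k
        · exact (hb 0 k).trans (by gcongr)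
    _ = _ := by ring

theorem kfMean_succ (μ : Fin n → ℝ) (u : ℕ → Fin m → ℝ) (y : ℕ → Fin p → ℝ) (k : ℕ) :
    kfMean A B C Q R P μ u y (k + 1) =
      closedLoop A C R (kfCov A C Q R P k) *ᵥ kfMean A B C Q R P μ u y k +
        ((A * gain C R (kfCov A C Q R P k)) *ᵥ y k + B *ᵥ u k) := by
  simp only [kfMean, closedLoop, Matrix.mulVec_add, Matrix.mulVec_sub, Matrix.mulVec_mulVec,
    Matrix.mul_sub, Matrix.sub_mulVec, Matrix.mul_one]
  abel

/-- Split so that the linear part is the stable loop of `P'`, while the forcing is the decaying gain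
difference applied to the innovation of the other filter. -/
theorem kfMean_sub_succ (μ : Fin n → ℝ) (u : ℕ → Fin m → ℝ) (y : ℕ → Fin p → ℝ) (k : ℕ) :
    kfMean A B C Q R P' μ u y (k + 1) - kfMean A B C Q R P μ u y (k + 1) =
      closedLoop A C R (kfCov A C Q R P' k) *ᵥ
          (kfMean A B C Q R P' μ u y k - kfMean A B C Q R P μ u y k) +
        (A * (gain C R (kfCov A C Q R P' k) - gain C R (kfCov A C Q R P k))) *ᵥ
          (y k - C *ᵥ kfMean A B C Q R P μ u y k) := by
  simp only [kfMean_succ, closedLoop, Matrix.mulVec_sub, Matrix.mulVec_mulVec,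
    Matrix.mul_sub, Matrix.sub_mul, Matrix.sub_mulVec, Matrix.mul_one, Matrix.mul_assoc]
  abel

theorem kfMean_zero_data (μ : Fin n → ℝ) (k : ℕ) :
    kfMean A B C Q R P μ 0 0 k = transMat A C Q R P 0 k *ᵥ μ := by
  induction k with
  | zero => simp [kfMean, transMat]
  | succ k ih => simp [kfMean_succ, ih, transMat, Matrix.mulVec_mulVec]

theorem psiHat_eq_transMat (k : ℕ) : psiHat A B C Q R k P = transMat A C Q R P 0 k := by
  ext i j
  simp [psiHat, kfMean_zero_data]

/-- Variation of constants for the filter error dynamics. -/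
theorem eq_sum_transMat (x g : ℕ → Fin n → ℝ) (h0 : x 0 = 0)
    (h : ∀ k, x (k + 1) = closedLoop A C R (kfCov A C Q R P k) *ᵥ x k + g k) (k : ℕ) :
    x k = ∑ j ∈ Finset.range k, transMat A C Q R P (j + 1) (k - 1 - j) *ᵥ g j := by
  induction k with
  | zero => simpa using h0
  | succ k ih =>
    rw [h, ih, Finset.sum_range_succ, Matrix.mulVec_sum]
    congr 1
    · refine Finset.sum_congr rfl fun j hj => ?_
      have hj := Finset.mem_range.1 hj
      rw [show k + 1 - 1 - j = (k - 1 - j) + 1 by omega, transMat, Matrix.mulVec_mulVec,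
        show j + 1 + (k - 1 - j) = k by omega]
    · simp [transMat]

theorem norm_le_sum_of_transMat_bound {c q : ℝ}
    (hb : ∀ s i, ‖transMat A C Q R P s i‖ ≤ c * q ^ i) (x g : ℕ → Fin n → ℝ) (h0 : x 0 = 0)
    (h : ∀ k, x (k + 1) = closedLoop A C R (kfCov A C Q R P k) *ᵥ x k + g k) (k : ℕ) :
    ‖WithLp.toLp 2 (x k)‖ ≤
      ∑ j ∈ Finset.range k, c * q ^ (k - 1 - j) * ‖WithLp.toLp 2 (g j)‖ := by
  rw [eq_sum_transMat x g h0 h k, WithLp.toLp_sum]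
  refine (norm_sum_le _ _).trans (Finset.sum_le_sum fun j _ => ?_)
  exact (norm_toLp_mulVec_le _ _).trans (mul_le_mul_of_nonneg_right (hb _ _) (norm_nonneg _))

/-- The predictions of two filters from data of total size at most one differ by an
exponentially small amount. -/
theorem exists_kfMean_sub_bound (B : Matrix (Fin n) (Fin m) ℝ) (hQ : Q.PosSemidef) (hR : R.PosDef)
    (hP : P.PosSemidef) (hP' : P'.PosSemidef) (hobs : IsObservable A C) {c q : ℝ}
    (hc : 0 < c) (hq : 0 < q) (hq1 : q < 1)
    (hb : ∀ s i, ‖transMat A C Q R P s i‖ ≤ c * q ^ i)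
    (hb' : ∀ s i, ‖transMat A C Q R P' s i‖ ≤ c * q ^ i) :
    ∃ D : ℝ, 0 ≤ D ∧ ∀ (u : ℕ → Fin m → ℝ) (y : ℕ → Fin p → ℝ),
      (∀ k, ∑ j ∈ Finset.range k, (‖WithLp.toLp 2 (y j)‖ + ‖WithLp.toLp 2 (u j)‖) ≤ 1) → ∀ k,
      ‖WithLp.toLp 2 (kfMean A B C Q R P' 0 u y k - kfMean A B C Q R P 0 u y k)‖
        ≤ D * k * q ^ k := by
  obtain ⟨b, hb0, hAK⟩ := exists_gain_bound hQ hR hP hobs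
  obtain ⟨r, hr, hRr⟩ := exists_pos_le_of_posDef hR
  have hpsd := kfCov_posSemidef A C Q hQ hR hP
  have hpsd' := kfCov_posSemidef A C Q hQ hR hP'
  set E : ℝ := c * (c * ‖P' - P‖ * c) * ‖Cᵀ‖ * r⁻¹ with hE
  have hE0 : 0 ≤ E := by positivity
  have hcov := kfCov_sub_norm_le hQ hR hP hP' hc hq hq1 hb hb'
  have hgain : ∀ k, ‖A * (gain C R (kfCov A C Q R P' k) - gain C R (kfCov A C Q R P k))‖
      ≤ E * q ^ k := by
    intro k
    rw [gain_sub_gain C hR (hpsd k) (hpsd' k)]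
    -- The factor `A` merges with `1 - K C` into a closed loop, a one-step transition matrix.
    have h1 : ‖closedLoop A C R (kfCov A C Q R P k)‖ ≤ c := by
      have := hb k 1
      simp only [transMat, add_zero, Matrix.mul_one, pow_one] at this
      exact this.trans (by nlinarith)
    have h2 : ‖(C * kfCov A C Q R P' k * Cᵀ + R)⁻¹‖ ≤ r⁻¹ := by
      refine norm_inv_le_of_le (isUnit_det_innovation C hR (hpsd' k)) hr fun z => ?_
      have h3 : (C * kfCov A C Q R P' k * Cᵀ).PosSemidef := by
        have := (hpsd' k).mul_mul_conjTranspose_same C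
        rwa [Matrix.conjTranspose_eq_transpose_of_trivial] at this
      rw [Matrix.add_mulVec, dotProduct_add]
      linarith [hRr z, posSemidef_dotProduct_nonneg h3 z]
    calc _ = ‖closedLoop A C R (kfCov A C Q R P k) * (kfCov A C Q R P' k - kfCov A C Q R P k) *
            Cᵀ * (C * kfCov A C Q R P' k * Cᵀ + R)⁻¹‖ := by
          simp only [closedLoop, Matrix.mul_assoc]
      _ ≤ ‖closedLoop A C R (kfCov A C Q R P k)‖ * ‖kfCov A C Q R P' k - kfCov A C Q R P k‖ *
            ‖Cᵀ‖ * ‖(C * kfCov A C Q R P' k * Cᵀ + R)⁻¹‖ := by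
          refine (Matrix.l2_opNorm_mul _ _).trans ?_
          gcongr
          refine (Matrix.l2_opNorm_mul _ _).trans ?_
          gcongr
          exact Matrix.l2_opNorm_mul _ _
      _ ≤ c * ((c * ‖P' - P‖ * c) * q ^ k) * ‖Cᵀ‖ * r⁻¹ := by
          gcongr
          exact hcov k
      _ = _ := by rw [hE]; ring
  set X : ℝ := c * (b + ‖B‖) with hX
  have hX0 : 0 ≤ X := by positivity
  refine ⟨c * (E * (1 + ‖C‖ * X)) / q, by positivity, fun u y hdata k => ?_⟩
  have hx : ∀ k, ‖WithLp.toLp 2 (kfMean A B C Q R P 0 u y k)‖ ≤ X := by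
    intro k
    refine (norm_le_sum_of_transMat_bound hb (kfMean A B C Q R P 0 u y) _ rfl
      (fun k => kfMean_succ 0 u y k) k).trans ?_
    calc _ ≤ ∑ j ∈ Finset.range k, X * (‖WithLp.toLp 2 (y j)‖ + ‖WithLp.toLp 2 (u j)‖) := by
          refine Finset.sum_le_sum fun j _ => ?_
          rw [hX, mul_assoc c (b + ‖B‖)]
          have h1 : c * q ^ (k - 1 - j) ≤ c * 1 := by
            gcongr
            exact pow_le_one₀ hq.le hq1.le
          rw [mul_one] at h1
          refine mul_le_mul h1 ?_ (norm_nonneg _) hc.le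
          rw [WithLp.toLp_add]
          refine (norm_add_le _ _).trans ?_
          have h2 := (norm_toLp_mulVec_le (A * gain C R (kfCov A C Q R P j)) (y j)).trans
            (mul_le_mul_of_nonneg_right (hAK j) (norm_nonneg _))
          have h3 := norm_toLp_mulVec_le B (u j)
          have h4 : 0 ≤ ‖B‖ * ‖WithLp.toLp 2 (y j)‖ := by positivity
          have h5 : 0 ≤ b * ‖WithLp.toLp 2 (u j)‖ := by positivity
          linarith
      _ ≤ X * 1 := by
          rw [← Finset.mul_sum]
          exact mul_le_mul_of_nonneg_left (hdata k) hX0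
      _ = X := mul_one X
  refine (norm_le_sum_of_transMat_bound hb'
    (fun k => kfMean A B C Q R P' 0 u y k - kfMean A B C Q R P 0 u y k) _ (sub_self _)
    (fun k => kfMean_sub_succ 0 u y k) k).trans ?_
  calc _ ≤ ∑ j ∈ Finset.range k, c * (E * (1 + ‖C‖ * X)) / q * q ^ k := by
        refine Finset.sum_le_sum fun j hj => ?_
        have hj := Finset.mem_range.1 hj
        have hy : ‖WithLp.toLp 2 (y j)‖ ≤ 1 := by
          have h1 := hdata (j + 1)
          rw [Finset.sum_range_succ] at h1
          have h2 : 0 ≤ ∑ j ∈ Finset.range j, (‖WithLp.toLp 2 (y j)‖ + ‖WithLp.toLp 2 (u j)‖) := by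
            positivity
          linarith [norm_nonneg (WithLp.toLp 2 (u j))]
        have h1 : ‖WithLp.toLp 2 (y j - C *ᵥ kfMean A B C Q R P 0 u y j)‖ ≤ 1 + ‖C‖ * X := by
          rw [WithLp.toLp_sub]
          refine (norm_sub_le _ _).trans (add_le_add hy ?_)
          exact (norm_toLp_mulVec_le _ _).trans
            (mul_le_mul_of_nonneg_left (hx j) (norm_nonneg _))
        -- Decay of the forcing up to `j` and of the transition after it combine to `q ^ (k - 1)`,
        -- whatever `j` is: hence the factor `k` and the division by `q`.
        calc _ ≤ c * q ^ (k - 1 - j) * ((E * q ^ j) * (1 + ‖C‖ * X)) := by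
              refine mul_le_mul_of_nonneg_left ?_ (by positivity)
              refine (norm_toLp_mulVec_le _ _).trans ?_
              exact mul_le_mul (hgain j) h1 (norm_nonneg _) (by positivity)
          _ = _ := by
              have hk : k = (k - 1 - j) + j + 1 := by omega
              conv_rhs => rw [hk, pow_succ, pow_add]
              field_simp
    _ = _ := by
        rw [Finset.sum_const, Finset.card_range, nsmul_eq_mul]
        ring

theorem sum_norm_single_le {a : ℕ} (t : ℕ) (i : Fin a) (k : ℕ) :
    ∑ j ∈ Finset.range k,
      ‖WithLp.toLp 2 ((Pi.single t (Pi.single i 1) : ℕ → Fin a → ℝ) j)‖ ≤ 1 := by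
  have h : ∀ j, ‖WithLp.toLp 2 ((Pi.single t (Pi.single i 1) : ℕ → Fin a → ℝ) j)‖ =
      if j = t then 1 else 0 := by
    intro j
    split_ifs with hj
    · subst hj
      rw [Pi.single_eq_same]
      simp
    · rw [Pi.single_eq_of_ne hj]
      simp
  simp only [h, Finset.sum_ite_eq', Finset.mem_range]
  split_ifs <;> norm_num

/-- Each data column is the output of one unit data sequence, and the `H_f` columns cancel. Summing
entries costs a factor linear in `k`. -/
theorem etaF_sub_norm_le {T k : ℕ} {a : ℝ}
    (h : ∀ (u : ℕ → Fin m → ℝ) (y : ℕ → Fin p → ℝ),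
      (∀ k, ∑ j ∈ Finset.range k, (‖WithLp.toLp 2 (y j)‖ + ‖WithLp.toLp 2 (u j)‖) ≤ 1) →
      ‖WithLp.toLp 2 (kfMean A B C Q R P' 0 u y k - kfMean A B C Q R P 0 u y k)‖ ≤ a) :
    ‖etaF A B C Q R T k P' - etaF A B C Q R T k P‖ ≤
      (T * p) * (k * m + k * p) * (‖obsMatrix A C T‖ * a) := by
  refine (l2_opNorm_le_sum_abs _).trans ?_
  have hentry : ∀ (i : Fin T × Fin p) (u : ℕ → Fin m → ℝ) (y : ℕ → Fin p → ℝ),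
      (∀ k, ∑ j ∈ Finset.range k, (‖WithLp.toLp 2 (y j)‖ + ‖WithLp.toLp 2 (u j)‖) ≤ 1) →
      |(obsMatrix A C T *ᵥ (kfMean A B C Q R P' 0 u y k - kfMean A B C Q R P 0 u y k)) i| ≤
        ‖obsMatrix A C T‖ * a := fun i u y huy =>
    (abs_apply_le_norm_toLp _ i).trans ((norm_toLp_mulVec_le _ _).trans
      (mul_le_mul_of_nonneg_left (h u y huy) (norm_nonneg _)))
  have hcol : ∀ i j, |(etaF A B C Q R T k P' - etaF A B C Q R T k P) i (Sum.inl j)| ≤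
      ‖obsMatrix A C T‖ * a := by
    intro i j
    rw [etaF, etaF, Matrix.sub_apply, Matrix.fromCols_apply_inl, Matrix.fromCols_apply_inl,
      ← Matrix.sub_apply, ← Matrix.mul_sub]
    rcases j with s | s
    · refine le_of_eq_of_le ?_ (hentry i (Pi.single (s.1 : ℕ) (Pi.single s.2 1)) 0 fun k => ?_)
      · rfl
      · simpa using sum_norm_single_le (s.1 : ℕ) s.2 k
    · refine le_of_eq_of_le ?_ (hentry i 0 (Pi.single (s.1 : ℕ) (Pi.single s.2 1)) fun k => ?_)
      · rfl
      · simpa using sum_norm_single_le (s.1 : ℕ) s.2 k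
  have hrow : ∀ i, ∑ j, |(etaF A B C Q R T k P' - etaF A B C Q R T k P) i j| ≤
      (k * m + k * p) * (‖obsMatrix A C T‖ * a) := by
    intro i
    rw [Fintype.sum_sum_type]
    have h2 : ∀ j, |(etaF A B C Q R T k P' - etaF A B C Q R T k P) i (Sum.inr j)| = 0 := by
      intro j
      simp [etaF]
    simp only [h2, Finset.sum_const_zero, add_zero]
    refine (Finset.sum_le_card_nsmul _ _ _ fun j _ => hcol i j).trans_eq ?_
    simp
  refine (Finset.sum_le_card_nsmul _ _ _ fun i _ => hrow i).trans_eq ?_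
  simp [mul_assoc]

theorem covF_sub_norm_le {T k : ℕ} :
    ‖covF A C Q R T k P' - covF A C Q R T k P‖ ≤
      ‖obsMatrix A C T‖ * ‖kfCov A C Q R P' k - kfCov A C Q R P k‖ * ‖(obsMatrix A C T)ᵀ‖ := by
  rw [covF, covF, add_sub_add_right_eq_sub, add_sub_add_right_eq_sub, ← Matrix.sub_mul,
    ← Matrix.mul_sub]
  exact (Matrix.l2_opNorm_mul _ _).trans
    (mul_le_mul_of_nonneg_right (Matrix.l2_opNorm_mul _ _) (norm_nonneg _))

end Comparison

/-! ### Decay rates and conclusion. -/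

/-- Of the two factors in `(ρ ^ 2) ^ k = ρ ^ k * ρ ^ k`, one cancels the weight and the other beats
the polynomial. -/
theorem tendsto_mul_zpow_of_le {f : ℕ → ℝ} {D ρ : ℝ} (hρ : 0 < ρ) (hρ1 : ρ < 1)
    (hf : ∀ k, 0 ≤ f k) (h : ∀ k : ℕ, f k ≤ D * ((k : ℝ) ^ 2 + 1) * (ρ ^ 2) ^ k) :
    Tendsto (fun k : ℕ => f k * ρ ^ (-(k : ℤ))) atTop (𝓝 0) := by
  have habs : |ρ| < 1 := by rwa [abs_of_pos hρ]
  have h1 := ((tendsto_pow_const_mul_const_pow_of_abs_lt_one 2 habs).add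
    (tendsto_pow_atTop_nhds_zero_of_lt_one hρ.le hρ1)).const_mul D
  simp only [add_zero, mul_zero] at h1
  refine squeeze_zero (fun k => mul_nonneg (hf k) (by positivity)) (fun k => ?_) h1
  rw [zpow_neg, zpow_natCast, ← div_eq_mul_inv, div_le_iff₀ (by positivity)]
  refine (h k).trans_eq ?_
  rw [← pow_mul, mul_comm 2 k, pow_mul]
  ring

end KFGap

end

theorem theorem2 {n m p : ℕ} (T : ℕ)
    (A : Matrix (Fin n) (Fin n) ℝ) (B : Matrix (Fin n) (Fin m) ℝ) (C : Matrix (Fin p) (Fin n) ℝ)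
    (Q : Matrix (Fin n) (Fin n) ℝ) (R : Matrix (Fin p) (Fin p) ℝ)
    (hQ : Q.PosSemidef) (hR : R.PosDef)
    (hobs : KFGap.IsObservable A C)
    (hstab : KFGap.IsStabilizable A (CFC.sqrt Q))
    (S P₁ : Matrix (Fin n) (Fin n) ℝ) (hS : S.PosDef) (hP₁ : P₁.PosDef) :
    ∃ ρ : ℝ, 0 < ρ ∧ ρ < 1 ∧
      Tendsto (fun Tini : ℕ =>
        ‖KFGap.etaF A B C Q R T Tini S - KFGap.etaF A B C Q R T Tini P₁‖ * ρ ^ (-(Tini : ℤ)))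
        atTop (𝓝 0) ∧
      Tendsto (fun Tini : ℕ =>
        ‖KFGap.obsMatrix A C T * KFGap.psiHat A B C Q R Tini P₁‖ * ρ ^ (-(Tini : ℤ)))
        atTop (𝓝 0) ∧
      Tendsto (fun Tini : ℕ =>
        ‖KFGap.covF A C Q R T Tini S - KFGap.covF A C Q R T Tini P₁‖ * ρ ^ (-(Tini : ℤ)))
        atTop (𝓝 0) := by
  obtain ⟨c₁, q₁, hc₁, hq₁, hq₁', hb₁⟩ :=
    KFGap.exists_transMat_bound hQ hR hS.posSemidef hobs hstab
  obtain ⟨c₂, q₂, hc₂, hq₂, hq₂', hb₂⟩ :=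
    KFGap.exists_transMat_bound hQ hR hP₁.posSemidef hobs hstab
  set c := max c₁ c₂
  set q := max q₁ q₂
  have hc : 0 < c := lt_max_of_lt_left hc₁
  have hq : 0 < q := lt_max_of_lt_left hq₁
  have hq' : q < 1 := max_lt hq₁' hq₂'
  have hbS : ∀ s i, ‖KFGap.transMat A C Q R S s i‖ ≤ c * q ^ i := fun s i =>
    (hb₁ s i).trans (mul_le_mul (le_max_left _ _)
      (pow_le_pow_left₀ hq₁.le (le_max_left _ _) i) (by positivity) hc.le)
  have hbP : ∀ s i, ‖KFGap.transMat A C Q R P₁ s i‖ ≤ c * q ^ i := fun s i =>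
    (hb₂ s i).trans (mul_le_mul (le_max_right _ _)
      (pow_le_pow_left₀ hq₂.le (le_max_right _ _) i) (by positivity) hc.le)
  obtain ⟨D, hD, hmean⟩ := KFGap.exists_kfMean_sub_bound B hQ hR hP₁.posSemidef hS.posSemidef hobs
    hc hq hq' hbP hbS
  have hsq : (√q) ^ 2 = q := Real.sq_sqrt hq.le
  have hρ : 0 < √q := Real.sqrt_pos.2 hq
  have hρ' : √q < 1 := by rwa [Real.sqrt_lt' one_pos, one_pow]
  set O := KFGap.obsMatrix A C T
  -- Taking `√q` rather than `q` leaves room for the factor `k ^ 2` in the first limit: one `k` from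
  -- the forced recursion, one from the number of data columns.
  refine ⟨√q, hρ, hρ', ?_, ?_, ?_⟩
  · refine KFGap.tendsto_mul_zpow_of_le (D := (T * p) * (m + p) * ‖O‖ * D) hρ hρ'
      (fun k => norm_nonneg _) fun k => ?_
    rw [hsq]
    refine (KFGap.etaF_sub_norm_le fun u y huy => hmean u y huy k).trans ?_
    have h1 : (0 : ℝ) ≤ (T * p) * (m + p) * ‖O‖ * D * q ^ k := by positivity
    linarith
  · refine KFGap.tendsto_mul_zpow_of_le (D := ‖O‖ * c) hρ hρ' (fun k => norm_nonneg _) fun k => ?_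
    rw [hsq, KFGap.psiHat_eq_transMat]
    refine (Matrix.l2_opNorm_mul _ _).trans ?_
    have h1 := mul_le_mul_of_nonneg_left (hbP 0 k) (norm_nonneg O)
    have h2 : 0 ≤ ‖O‖ * c * (k : ℝ) ^ 2 * q ^ k := by positivity
    linarith
  · refine KFGap.tendsto_mul_zpow_of_le (D := ‖O‖ * (c * ‖S - P₁‖ * c) * ‖Oᵀ‖) hρ hρ'
      (fun k => norm_nonneg _) fun k => ?_
    rw [hsq]
    refine KFGap.covF_sub_norm_le.trans ?_
    have h1 := KFGap.kfCov_sub_norm_le hQ hR hP₁.posSemidef hS.posSemidef hc hq hq' hbP hbS k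
    have h2 := mul_le_mul_of_nonneg_right (mul_le_mul_of_nonneg_left h1 (norm_nonneg O))
      (norm_nonneg Oᵀ)
    have h3 : 0 ≤ ‖O‖ * (c * ‖S - P₁‖ * c) * ‖Oᵀ‖ * (k : ℝ) ^ 2 * q ^ k := by positivity
    linarith
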